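/- For a Tychonoff space $X$, let $\operatorname{Homeo}_{cpt}(X)$ be the group of homeomorphisms $h$ of $X$ whose support $\operatorname{cl}_X\{x\in X : h(x)\neq x\}$ is compact. Extending each such $h$ to the Stone–Čech compactification $\beta X$ makes $\operatorname{Homeo}_{cpt}(X)$ a subgroup of $\operatorname{Homeo}(\beta X)$, and $\operatorname{Homeo}_{cpt}(X)$ is given the topology induced by the compact-open topology on $\operatorname{Homeo}(\beta X)$. For a compact subset $K$ of $X$, let $\operatorname{Homeo}_K(X)$ be the group of homeomorphisms of $X$ that are the identity outside $K$, with the compact-open topology. One says that $X$ has the Compactly Supported Homeomorphism Property (CSHP) if the topology of $\operatorname{Homeo}_{cpt}(X)$ coincides with the colimit space topology, that is, the finest topology on $\operatorname{Homeo}_{cpt}(X)=\bigcup_K \operatorname{Homeo}_K(X)$ that makes every inclusion $\operatorname{Homeo}_K(X)\to\operatorname{Homeo}_{cpt}(X)$ ($K\subseteq X$ compact) continuous. The closed long ray $\mathbb{L}_{\geq 0}$ is $\omega_1\times[0,1)$ with the order topology of the lexicographic order. The long line $\mathbb{L}$ is obtained by gluing two copies of $\mathbb{L}_{\geq 0}$,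 one with the reverse order and one with the usual order, at their boundary points $(0,0)$. Theorem D. Suppose that (a) $X=\mathbb{L}_{\geq 0}$; or (b) $X=\mathbb{L}$; or (c) $X=\kappa^n\times\lambda_1\times\cdots\times\lambda_j$ with the product topology, where $\kappa$ is an uncountable regular cardinal, $\lambda_1,\ldots,\lambda_j$ are successor ordinals smaller than $\kappa$, $n,j\in\mathbb{N}=\{0,1,2,\ldots\}$, and $\kappa$ and each $\lambda_i$ carry the order topology. Then $X$ has CSHP. -/

import Mathlib

/-! ### Compactly supported homeomorphisms -/

/-- The support of a homeomorphism `h : X → X`: the closure of the set of points moved by `h`. -/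
def homeoSupport {X : Type*} [TopologicalSpace X] (h : X ≃ₜ X) : Set X :=
  closure {x | h x ≠ x}

/-- `Homeo_K(X)`: the homeomorphisms of `X` that are the identity outside `K`. -/
def homeoFixingOutside (X : Type*) [TopologicalSpace X] (K : Set X) : Subgroup (X ≃ₜ X) where
  carrier := {h | ∀ x, x ∉ K → h x = x}
  one_mem' := fun _ _ => rfl
  mul_mem' := by
    intro f g hf hg x hx
    show f (g x) = x
    rw [hg x hx, hf x hx]
  inv_mem' := by
    intro f hf x hx
    show f.symm x = x
    rw [Homeomorph.symm_apply_eq, hf x hx]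

/-- `Homeo_cpt(X)`: the homeomorphisms of `X` with compact support. -/
def homeoCpt (X : Type*) [TopologicalSpace X] : Subgroup (X ≃ₜ X) where
  carrier := {h | IsCompact (homeoSupport h)}
  one_mem' := by
    have : {x : X | (1 : X ≃ₜ X) x ≠ x} = ∅ := by
      ext x
      simp only [Set.mem_ofPred_eq, Set.mem_empty_iff_false, iff_false, not_not]
      rfl
    show IsCompact (closure {x : X | (1 : X ≃ₜ X) x ≠ x})
    rw [this, closure_empty]
    exact isCompact_empty
  mul_mem' := by
    intro f g hf hg
    refine (hf.union hg).of_isClosed_subset isClosed_closure ?_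
    show closure _ ⊆ closure _ ∪ closure _
    rw [← closure_union]
    refine closure_mono fun x hx => ?_
    by_contra hcon
    simp only [Set.mem_union, Set.mem_ofPred_eq, not_or, not_not] at hcon
    apply hx
    show f (g x) = x
    rw [hcon.2, hcon.1]
  inv_mem' := by
    intro f hf
    have : {x : X | (f⁻¹ : X ≃ₜ X) x ≠ x} = {x : X | f x ≠ x} := by
      ext x
      show f.symm x ≠ x ↔ f x ≠ x
      rw [Ne, Ne, Homeomorph.symm_apply_eq, eq_comm]
    show IsCompact (closure {x : X | (f⁻¹ : X ≃ₜ X) x ≠ x})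
    rw [this]
    exact hf

/-- In a Hausdorff space, a homeomorphism that is the identity outside a compact set has compact
support, so that `Homeo_K(X) ≤ Homeo_cpt(X)` for compact `K`. -/
theorem homeoFixingOutside_le_homeoCpt (X : Type*) [TopologicalSpace X] [T2Space X]
    (K : TopologicalSpace.Compacts X) : homeoFixingOutside X (K : Set X) ≤ homeoCpt X := by
  intro f hf
  refine K.isCompact.of_isClosed_subset isClosed_closure
    (closure_minimal (fun x hx => ?_) K.isCompact.isClosed)
  by_contra hxK
  exact hx (hf x hxK)

/-- The compact-open topology on the set of self-homeomorphisms of `Y`. -/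
abbrev homeoCompactOpen (Y : Type*) [TopologicalSpace Y] : TopologicalSpace (Y ≃ₜ Y) :=
  TopologicalSpace.induced (fun h => (⟨h, h.continuous⟩ : C(Y, Y))) ContinuousMap.compactOpen

/-- The compact-open topology on `Homeo_K(X)`. -/
abbrev homeoFixingOutsideTopology (X : Type*) [TopologicalSpace X] (K : Set X) :
    TopologicalSpace (homeoFixingOutside X K) :=
  TopologicalSpace.induced Subtype.val (homeoCompactOpen X)

/-- The extension of a homeomorphism of `X` to the Stone-Čech compactification of `X`. -/
noncomputable def homeoBeta {X : Type*} [TopologicalSpace X] (h : X ≃ₜ X) :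
    StoneCech X ≃ₜ StoneCech X where
  toFun := stoneCechExtend (continuous_stoneCechUnit.comp h.continuous)
  invFun := stoneCechExtend (continuous_stoneCechUnit.comp h.symm.continuous)
  left_inv := by
    refine congrFun (stoneCech_hom_ext (g₂ := id)
      ((continuous_stoneCechExtend _).comp (continuous_stoneCechExtend _)) continuous_id ?_)
    ext x
    simp
  right_inv := by
    refine congrFun (stoneCech_hom_ext (g₂ := id)
      ((continuous_stoneCechExtend _).comp (continuous_stoneCechExtend _)) continuous_id ?_)
    ext x
    simp
  continuous_toFun := continuous_stoneCechExtend _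
  continuous_invFun := continuous_stoneCechExtend _

/-- The topology on `Homeo_cpt(X)` induced by the compact-open topology on `Homeo(βX)`. -/
noncomputable abbrev homeoCptBetaTopology (X : Type*) [TopologicalSpace X] : TopologicalSpace (homeoCpt X) :=
  TopologicalSpace.induced (fun h => homeoBeta (h : X ≃ₜ X)) (homeoCompactOpen (StoneCech X))

/-- The colimit space topology on `Homeo_cpt(X)`: the finest topology making each inclusion
`Homeo_K(X) → Homeo_cpt(X)` continuous, where `K` ranges over the compact subsets of `X`. -/
abbrev homeoCptColimitTopology (X : Type*) [TopologicalSpace X] [T2Space X] :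
    TopologicalSpace (homeoCpt X) :=
  ⨆ K : TopologicalSpace.Compacts X,
    TopologicalSpace.coinduced (Subgroup.inclusion (homeoFixingOutside_le_homeoCpt X K))
      (homeoFixingOutsideTopology X (K : Set X))

/-- The Compactly Supported Homeomorphism Property of a Tychonoff space. -/
def CSHP (X : Type*) [TopologicalSpace X] [T35Space X] : Prop :=
  homeoCptColimitTopology X = homeoCptBetaTopology X

/-! ### The closed long ray and the long line -/

/-- The closed long ray: `ω₁ × [0,1)` with the lexicographic order. -/
def ClosedLongRay : Type 1 :=
  Set.Iio (Ordinal.omega 1 : Ordinal.{0}) ×ₗ Set.Ico (0 : ℝ) 1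

noncomputable instance : LinearOrder ClosedLongRay :=
  inferInstanceAs (LinearOrder (Set.Iio (Ordinal.omega 1 : Ordinal.{0}) ×ₗ Set.Ico (0 : ℝ) 1))

noncomputable instance : TopologicalSpace ClosedLongRay := Preorder.topology ClosedLongRay

instance : OrderTopology ClosedLongRay := ⟨rfl⟩

/-- The boundary point `(0, 0)` of the closed long ray. -/
noncomputable def ClosedLongRay.origin : ClosedLongRay :=
  toLex (⟨0, Ordinal.omega_pos 1⟩, ⟨0, le_rfl, zero_lt_one⟩)

/-- The long line: two copies of the closed long ray, the first one with the reverse order, glued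
together at their boundary points. The common boundary point is counted only once, as a point of
the second copy, and every point of the first copy precedes every point of the second one. -/
def LongLine : Type 1 :=
  (Set.Ioi ClosedLongRay.origin)ᵒᵈ ⊕ₗ ClosedLongRay

noncomputable instance : LinearOrder LongLine :=
  inferInstanceAs (LinearOrder ((Set.Ioi ClosedLongRay.origin)ᵒᵈ ⊕ₗ ClosedLongRay))

noncomputable instance : TopologicalSpace LongLine := Preorder.topology LongLine

instance : OrderTopology LongLine := ⟨rfl⟩

universe u

open Set Filter Topology


/-! ### The colimit topology is finer than the topology induced from `βX` -/

/-! The colimit topology is always finer than the one induced from `βX`. For the converse, let `A`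
be closed in the colimit topology and `f` in its closure for the `βX` topology; `f ∈ A` is shown by
a reflection argument (`CSHP.of_reflection`).

Every continuous `φ : X → [0,1]` extends to `βX`, so some `h ∈ A` is uniformly close to `f` when
tested against any finite set of such functions, but its support is not controlled. Exhaust `X` by
compact sets `K α`, and attach to each `α` a set `S α` of test functions so small that the supports
of one chosen `h` for each finite subset of `S α` and each precision fit into a common `K β`.
Iterating `α ↦ β` gives a sequence `a n`. With `α` its supremum, all these approximations, and `f`
itself, live on `K α`. If the functions in `⋃ n, S (a n)` separate the points of `K α`, they
determine the topology of `Homeo_{K α}`, so the approximations converge to `f` there, and `f ∈ A`.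

Separation holds because comparing two points `x < y` of `K α` takes only test functions indexed
strictly below `α`: in ordinals, the indicator of `Iic x`; in the long ray, an Urysohn function
between two rational points in the fibre of `x`. -/

theorem homeoBeta_stoneCechUnit {X : Type*} [TopologicalSpace X] (h : X ≃ₜ X) (x : X) :
    homeoBeta h (stoneCechUnit x) = stoneCechUnit (h x) :=
  stoneCechExtend_stoneCechUnit (continuous_stoneCechUnit.comp h.continuous) x

/-- The extension of a homeomorphism supported on `K` fixes the points of `βX` outside `K`. -/
theorem homeoBeta_eq_self {X : Type*} [TopologicalSpace X] {K : Set X} (hK : IsCompact K)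
    {h : X ≃ₜ X} (hh : h ∈ homeoFixingOutside X K) {y : StoneCech X}
    (hy : y ∉ stoneCechUnit '' K) : homeoBeta h y = y := by
  have hcl : IsClosed (stoneCechUnit '' K) := (hK.image continuous_stoneCechUnit).isClosed
  have hfix : IsClosed {y : StoneCech X | homeoBeta h y = y} :=
    isClosed_eq (homeoBeta h).continuous continuous_id
  refine closure_minimal ?_ hfix
    (denseRange_stoneCechUnit.open_subset_closure_inter hcl.isOpen_compl hy)
  rintro _ ⟨hz, x, rfl⟩
  have hx : x ∉ K := fun hx => hz ⟨x, hx, rfl⟩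
  simp only [mem_ofPred_eq]
  rw [homeoBeta_stoneCechUnit, hh x hx]

/-- The extension of `h` is the identity off the image of `K`. Hence "`C` is mapped into `W`"
imposes a condition independent of `h` on that part of `C`, and a compact-open condition on `K ∩ C`.
-/
theorem continuous_homeoBeta_fixingOutside {X : Type*} [TopologicalSpace X] {K : Set X}
    (hK : IsCompact K) :
    Continuous[homeoFixingOutsideTopology X K, homeoCompactOpen (StoneCech X)]
      (fun h : homeoFixingOutside X K => homeoBeta (h : X ≃ₜ X)) := by
  let _ := homeoFixingOutsideTopology X K
  let _ := homeoCompactOpen X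
  rw [continuous_induced_rng, ContinuousMap.continuous_compactOpen]
  intro C hC W hW
  by_cases hCW : C \ stoneCechUnit '' K ⊆ W
  · have hC' : IsCompact (K ∩ stoneCechUnit ⁻¹' C) :=
      hK.inter_right (hC.isClosed.preimage continuous_stoneCechUnit)
    have hcont : Continuous (fun h : homeoFixingOutside X K =>
        (⟨(h : X ≃ₜ X), (h : X ≃ₜ X).continuous⟩ : C(X, X))) :=
      (continuous_induced_dom (f := fun h : X ≃ₜ X => (⟨h, h.continuous⟩ : C(X, X)))).comp
        (continuous_induced_dom (f := Subtype.val))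
    convert (ContinuousMap.isOpen_setOfPred_mapsTo hC'
      (hW.preimage continuous_stoneCechUnit)).preimage hcont using 1
    ext h
    constructor
    · rintro hh x ⟨-, hxC⟩
      have := hh hxC
      simpa [homeoBeta_stoneCechUnit] using this
    · intro hh y hy
      by_cases hyK : y ∈ stoneCechUnit '' K
      · obtain ⟨x, hx, rfl⟩ := hyK
        have := hh ⟨hx, hy⟩
        simpa [homeoBeta_stoneCechUnit] using this
      · have := homeoBeta_eq_self hK h.2 hyK
        simpa [this] using hCW ⟨hy, hyK⟩
  · convert isOpen_empty
    rw [eq_empty_iff_forall_notMem]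
    intro h hh
    refine hCW fun y hy => ?_
    have := hh hy.1
    simpa [homeoBeta_eq_self hK h.2 hy.2] using this

theorem homeoCptColimitTopology_le {X : Type*} [TopologicalSpace X] [T2Space X] :
    homeoCptColimitTopology X ≤ homeoCptBetaTopology X := by
  refine iSup_le fun K => ?_
  rw [← continuous_iff_coinduced_le, continuous_induced_rng]
  exact continuous_homeoBeta_fixingOutside K.isCompact

/-! ### Neighbourhoods given by bounded continuous functions -/

/-- Since `βX` is compact, the compact-open topology on `C(βX, ℝ)` is that of the sup metric, and
composing with the extension of `φ` is continuous. -/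
theorem eventually_homeoCptBeta_abs_sub_lt {X : Type*} [TopologicalSpace X] (f : homeoCpt X)
    (φ : C(X, ℝ)) (hφ : ∀ x, φ x ∈ Icc (0 : ℝ) 1) {ε : ℝ} (hε : 0 < ε) :
    ∀ᶠ h : homeoCpt X in @nhds _ (homeoCptBetaTopology X) f,
      ∀ x, |φ ((h : X ≃ₜ X) x) - φ ((f : X ≃ₜ X) x)| < ε := by
  let _ := homeoCptBetaTopology X
  let _ := homeoCompactOpen (StoneCech X)
  let ψ : X → Icc (0 : ℝ) 1 := fun x => ⟨φ x, hφ x⟩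
  have hψ : Continuous ψ := φ.continuous.subtype_mk _
  let Φ : C(StoneCech X, ℝ) :=
    ⟨Subtype.val ∘ stoneCechExtend hψ,
      continuous_subtype_val.comp (continuous_stoneCechExtend hψ)⟩
  have hΦ : ∀ x, Φ (stoneCechUnit x) = φ x := fun x =>
    congrArg Subtype.val (stoneCechExtend_stoneCechUnit hψ x)
  let G : homeoCpt X → C(StoneCech X, ℝ) := fun h =>
    Φ.comp ⟨homeoBeta (h : X ≃ₜ X), (homeoBeta (h : X ≃ₜ X)).continuous⟩
  have hG : Continuous G :=
    (ContinuousMap.continuous_postcomp Φ).comp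
      ((continuous_induced_dom (f := fun h : StoneCech X ≃ₜ StoneCech X =>
        (⟨h, h.continuous⟩ : C(StoneCech X, StoneCech X)))).comp
          (continuous_induced_dom (f := fun h : homeoCpt X => homeoBeta (h : X ≃ₜ X))))
  filter_upwards [hG.continuousAt.eventually (Metric.ball_mem_nhds (G f) hε)] with h hh x
  have := (ContinuousMap.dist_lt_iff hε).1 hh (stoneCechUnit x)
  simpa [G, homeoBeta_stoneCechUnit, hΦ, Real.dist_eq] using this

/-- A family of continuous functions that separates the points of a compact set `K` separates
disjoint compact subsets of `K` uniformly. -/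
theorem IsCompact.exists_finset_abs_sub_gt {X T : Type*} [TopologicalSpace X] {P Q : Set X}
    (hP : IsCompact P) (hQ : IsCompact Q) (φ : T → C(X, ℝ))
    (hsep : ∀ p ∈ P, ∀ q ∈ Q, ∃ t, φ t p ≠ φ t q) :
    ∃ (F : Finset T) (n : ℕ), ∀ p ∈ P, ∀ q ∈ Q, ∃ t ∈ F, 1 / ((n : ℝ) + 1) < |φ t p - φ t q| := by
  classical
  let U : Finset T × ℕ → Set (X × X) := fun i =>
    {z | ∃ t ∈ i.1, 1 / ((i.2 : ℝ) + 1) < |φ t z.1 - φ t z.2|}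
  have hU : ∀ i, IsOpen (U i) := by
    intro i
    have : U i = ⋃ t ∈ i.1, {z : X × X | 1 / ((i.2 : ℝ) + 1) < |φ t z.1 - φ t z.2|} := by
      ext z; simp [U]
    rw [this]
    refine isOpen_biUnion fun t _ => isOpen_lt continuous_const ?_
    fun_prop
  -- Monotonicity makes the cover directed, so a single pair `(F, n)` suffices.
  have hmono : Monotone U := by
    rintro ⟨F, n⟩ ⟨F', n'⟩ ⟨hF, hn⟩ z ⟨t, ht, hz⟩
    exact ⟨t, hF ht, (Nat.one_div_le_one_div hn).trans_lt hz⟩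
  obtain ⟨⟨F, n⟩, hFn⟩ := (hP.prod hQ).elim_directed_cover U hU (by
    rintro ⟨p, q⟩ ⟨hp, hq⟩
    obtain ⟨t, ht⟩ := hsep p hp q hq
    obtain ⟨n, hn⟩ := exists_nat_one_div_lt (abs_pos.2 (sub_ne_zero.2 ht))
    exact mem_iUnion.2 ⟨({t}, n), t, Finset.mem_singleton_self t, hn⟩) hmono.directed_le
  exact ⟨F, n, fun p hp q hq => hFn (mk_mem_prod hp hq)⟩

theorem mapsTo_of_mem_homeoFixingOutside {X : Type*} [TopologicalSpace X] {K : Set X}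
    {h : X ≃ₜ X} (hh : h ∈ homeoFixingOutside X K) : MapsTo h K K := by
  intro x hx
  by_contra hn
  exact hn (by rwa [h.injective (hh _ hn)])

/-- Convergence in `Homeo_K(X)` can be tested on functions separating the points of `K`. -/
theorem tendsto_homeoFixingOutside {X T : Type*} [TopologicalSpace X] [T2Space X]
    {K : Set X} (hK : IsCompact K) (φ : T → C(X, ℝ))
    (hsep : ∀ x ∈ K, ∀ y ∈ K, x ≠ y → ∃ t, φ t x ≠ φ t y)
    (f : homeoFixingOutside X K) (h : Finset T × ℕ → homeoFixingOutside X K)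
    (hh : ∀ i, ∀ t ∈ i.1, ∀ x,
      |φ t ((h i : X ≃ₜ X) x) - φ t ((f : X ≃ₜ X) x)| < 1 / ((i.2 : ℝ) + 1)) :
    Tendsto h atTop (@nhds _ (homeoFixingOutsideTopology X K) f) := by
  let _ := homeoCompactOpen X
  let _ := homeoFixingOutsideTopology X K
  rw [nhds_induced, tendsto_comap_iff, nhds_induced, tendsto_comap_iff,
    ContinuousMap.tendsto_nhds_compactOpen]
  intro C hC U hU hfU
  -- `f '' (K ∩ C)` and `K \ U` are disjoint compact sets, hence uniformly apart for finitely many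
  -- `φ t`. Any `h` closer to `f` than that cannot move a point of `K ∩ C` into `K \ U`, and it
  -- preserves `K`.
  have hP : IsCompact ((f : X ≃ₜ X) '' (K ∩ C)) := (hK.inter hC).image (f : X ≃ₜ X).continuous
  have hQ : IsCompact (K \ U) := hK.diff hU
  obtain ⟨F, n, hF⟩ := hP.exists_finset_abs_sub_gt hQ φ (by
    rintro _ ⟨x, hx, rfl⟩ q hq
    refine hsep _ (mapsTo_of_mem_homeoFixingOutside f.2 hx.1) _ hq.1 ?_
    rintro rfl
    exact hq.2 (hfU hx.2))
  filter_upwards [eventually_ge_atTop (F, n)] with i hi x hx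
  by_cases hxK : x ∈ K
  · by_contra hn
    obtain ⟨t, ht, hlt⟩ := hF _ ⟨x, ⟨hxK, hx⟩, rfl⟩ ((h i : X ≃ₜ X) x)
      ⟨mapsTo_of_mem_homeoFixingOutside (h i).2 hxK, hn⟩
    have h1 := hh i t (hi.1 ht) x
    rw [abs_sub_comm] at h1
    have h2 : 1 / ((i.2 : ℝ) + 1) ≤ 1 / ((n : ℝ) + 1) := Nat.one_div_le_one_div hi.2
    linarith
  · have h1 := hfU hx
    have h2 := f.2 x hxK
    have h3 := (h i).2 x hxK
    simp only [ContinuousMap.coe_mk] at h1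
    rw [h2] at h1
    simpa [h3] using h1

/-! ### The reflection argument -/

/-- `hbdd` says that each `S α` is small compared with the cofinality of `I`; `hlim` says that at a
bound of a sequence of stages the functions collected along the way suffice. -/
theorem CSHP.of_reflection {X : Type*} [TopologicalSpace X] [T35Space X] {I T : Type*}
    [SemilatticeSup I] (K : I → TopologicalSpace.Compacts X) (hK : Monotone K)
    (hcof : ∀ C : Set X, IsCompact C → ∃ α, C ⊆ K α)
    (φ : T → C(X, ℝ)) (hφ : ∀ t x, φ t x ∈ Icc (0 : ℝ) 1) (S : I → Set T) (hS : Monotone S)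
    (hbdd : ∀ α (g : Finset (S α) × ℕ → I), BddAbove (range g))
    (hlim : ∀ a : ℕ → I, Monotone a → ∃ α, (∀ n, a n ≤ α) ∧
      ∀ x ∈ K α, ∀ y ∈ K α, x ≠ y → ∃ n, ∃ t ∈ S (a n), φ t x ≠ φ t y) :
    CSHP X := by
  classical
  have hmemK : ∀ h : homeoCpt X, ∃ α, (h : X ≃ₜ X) ∈ homeoFixingOutside X (K α) := by
    intro h
    obtain ⟨α, hα⟩ := hcof _ h.2
    refine ⟨α, fun x hx => ?_⟩
    by_contra hn
    exact hx (hα (subset_closure hn))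
  refine le_antisymm homeoCptColimitTopology_le ?_
  let _ := homeoCptBetaTopology X
  intro O hO
  rw [← @isClosed_compl_iff _ (homeoCptColimitTopology X), isClosed_iSup_iff] at hO
  change IsOpen O
  rw [← isClosed_compl_iff]
  set A := Oᶜ
  refine isClosed_of_closure_subset fun f hf => ?_
  have happrox : ∀ (F : Finset T) (n : ℕ), ∃ h ∈ A, ∀ t ∈ F, ∀ x,
      |φ t ((h : X ≃ₜ X) x) - φ t ((f : X ≃ₜ X) x)| < 1 / ((n : ℝ) + 1) := by
    intro F n
    have hn := (mem_closure_iff_frequently.1 hf).and_eventually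
      ((Filter.eventually_all_finset F).2 fun t _ =>
        eventually_homeoCptBeta_abs_sub_lt f (φ t) (hφ t) (ε := 1 / ((n : ℝ) + 1)) (by positivity))
    obtain ⟨h, hA, hh⟩ := hn.exists
    exact ⟨h, hA, hh⟩
  have hnext : ∀ α, ∃ β, α ≤ β ∧ ∀ (F : Finset T) (n : ℕ), (∀ t ∈ F, t ∈ S α) → ∃ h ∈ A,
      (h : X ≃ₜ X) ∈ homeoFixingOutside X (K β) ∧ ∀ t ∈ F, ∀ x,
      |φ t ((h : X ≃ₜ X) x) - φ t ((f : X ≃ₜ X) x)| < 1 / ((n : ℝ) + 1) := by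
    intro α
    -- Fix one approximation `u F n` per task; for `F` inside `S α` the indices of their supports
    -- are bounded by `hbdd`.
    choose u hu hu' using happrox
    choose γ hγ using hmemK
    obtain ⟨β, hβ⟩ := hbdd α fun i => γ (u (i.1.map (Function.Embedding.subtype _)) i.2)
    refine ⟨α ⊔ β, le_sup_left, fun F n hF => ⟨u F n, hu F n, fun x hx => ?_, hu' F n⟩⟩
    have hle := hβ ⟨(F.subtype (· ∈ S α), n), rfl⟩
    simp only [Finset.subtype_map_of_mem hF] at hle
    exact hγ _ x fun hx' => hx (hK (hle.trans le_sup_right) hx')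
  choose next hle hnext using hnext
  obtain ⟨α₀, hα₀⟩ := hmemK f
  let a : ℕ → I := fun n => next^[n] α₀
  have ha : ∀ n, a (n + 1) = next (a n) := fun n => Function.iterate_succ_apply' next n α₀
  have hamono : Monotone a := monotone_nat_of_le_succ fun n => (hle _).trans_eq (ha n).symm
  obtain ⟨α, hα, hsep⟩ := hlim a hamono
  have hfix : ∀ {n} {h : X ≃ₜ X}, h ∈ homeoFixingOutside X (K (a n)) →
      h ∈ homeoFixingOutside X (K α) := fun {n h} hh x hx =>
    hh x fun hx' => hx (hK (hα n) hx')
  let Ψ : Set T := ⋃ n, S (a n)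
  have hseq : ∀ i : Finset Ψ × ℕ, ∃ h : homeoFixingOutside X (K α),
      Subgroup.inclusion (homeoFixingOutside_le_homeoCpt X (K α)) h ∈ A ∧ ∀ t ∈ i.1, ∀ x,
        |φ t ((h : X ≃ₜ X) x) - φ t ((f : X ≃ₜ X) x)| < 1 / ((i.2 : ℝ) + 1) := by
    -- A finite subset of the increasing union lies in a single `S (a m)`; its approximation is
    -- supported in `K (a (m + 1))`.
    rintro ⟨F, n⟩
    choose k hk using fun t : Ψ => mem_iUnion.1 t.2
    obtain ⟨h, hA, hh, hlt⟩ := hnext (a (F.sup k)) (F.map (Function.Embedding.subtype _)) n (by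
      intro t ht
      obtain ⟨t, ht', rfl⟩ := Finset.mem_map.1 ht
      exact hS (hamono (Finset.le_sup (f := k) ht')) (hk t))
    rw [← ha] at hh
    exact ⟨⟨h, hfix hh⟩, hA, fun t ht => hlt t (Finset.mem_map_of_mem _ ht)⟩
  choose h hA hh using hseq
  let f' : homeoFixingOutside X (K α) := ⟨f, hfix (n := 0) hα₀⟩
  have htend := tendsto_homeoFixingOutside (K α).isCompact (fun t : Ψ => φ t) (by
    intro x hx y hy hxy
    obtain ⟨n, t, ht, hne⟩ := hsep x hx y hy hxy
    exact ⟨⟨t, mem_iUnion.2 ⟨n, ht⟩⟩, hne⟩) f' h hh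
  let _ := homeoFixingOutsideTopology X (K α)
  exact (isClosed_coinduced.1 (hO (K α))).mem_of_tendsto htend (Eventually.of_forall hA)


/-! ### Initial segments of the ordinals -/

universe v

theorem Ordinal.bddAbove_range_Iio {o : Ordinal.{u}} {J : Type v}
    (hJ : Cardinal.lift.{u} (Cardinal.mk J) < (Ordinal.lift.{v} o).cof) (g : J → Iio o) :
    BddAbove (range g) := by
  refine ⟨⟨⨆ i, (g i : Ordinal), Ordinal.lift_iSup_lt_of_lt_cof hJ fun i => (g i).2⟩, ?_⟩
  rintro _ ⟨i, rfl⟩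
  exact le_ciSup (f := fun i => (g i : Ordinal)) ⟨o, by rintro _ ⟨i, rfl⟩; exact (g i).2.le⟩ i

theorem Ordinal.exists_isLUB_Iio {o : Ordinal.{u}} {J : Type v} [Nonempty J] {g : J → Iio o}
    (hg : BddAbove (range g)) : ∃ α, IsLUB (range g) α := by
  obtain ⟨b, hb⟩ := hg
  obtain ⟨α, hα, hmin⟩ := WellFounded.has_min (wellFounded_lt (α := Iio o)) (upperBounds (range g))
    ⟨b, hb⟩
  exact ⟨α, hα, fun c hc => not_lt.1 (hmin c hc)⟩

theorem Cardinal.lift_lt_cof_lift_ord {κ : Cardinal.{u}} (hκ : κ.IsRegular) {J : Type v}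
    (hJ : Cardinal.lift.{u} (Cardinal.mk J) < Cardinal.lift.{v} κ) :
    Cardinal.lift.{u} (Cardinal.mk J) < (Ordinal.lift.{v} κ.ord).cof := by
  rwa [← Ordinal.lift_cof, hκ.cof_ord]

theorem Cardinal.mk_finset_prod_nat_lt {J : Type v} {c : Cardinal.{v}}
    (hc : Cardinal.aleph0 < c) (hJ : Cardinal.mk J < c) : Cardinal.mk (Finset J × ℕ) < c := by
  rw [Cardinal.mk_prod, Cardinal.mk_nat, Cardinal.lift_aleph0, Cardinal.lift_uzero]
  refine Cardinal.mul_lt_of_lt hc.le ?_ hc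
  rcases finite_or_infinite J with h | h
  · exact (Cardinal.lt_aleph0_of_finite _).trans hc
  · rwa [Cardinal.mk_finset_of_infinite]

theorem Ordinal.isCompact_Iic_Iio {o : Ordinal.{u}} (α : Iio o) : IsCompact (Iic α) := by
  rw [IsInducing.subtypeVal.isCompact_iff]
  convert isCompact_Icc (a := (0 : Ordinal.{u})) (b := (α : Ordinal.{u})) using 1
  ext x
  constructor
  · rintro ⟨y, hy, rfl⟩
    exact ⟨zero_le, hy⟩
  · rintro ⟨-, hx⟩
    exact ⟨⟨x, hx.trans_lt α.2⟩, hx, rfl⟩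

theorem Ordinal.compactSpace_Iio_succ (μ : Ordinal.{u}) : CompactSpace (Iio (Order.succ μ)) := by
  refine ⟨?_⟩
  convert isCompact_Iic_Iio (⟨μ, Order.lt_succ μ⟩ : Iio (Order.succ μ)) using 1
  exact (eq_univ_of_forall fun x : Iio (Order.succ μ) =>
    show (x : Ordinal) ≤ μ from Order.lt_succ_iff.1 x.2).symm

theorem Ordinal.isClopen_Iic (δ : Ordinal.{u}) : IsClopen (Iic δ) :=
  ⟨isClosed_Iic, by rw [← Order.Iio_succ]; exact isOpen_Iio⟩

/-! ### Products of ordinals -/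

theorem cshp_pi_ordinal_prod {κ : Cardinal.{u}} (hκ : Cardinal.aleph0 < κ) (hreg : κ.IsRegular)
    (n j : ℕ) (lam : Fin j → Ordinal.{u}) (hsucc : ∀ i, ∃ μ : Ordinal.{u}, lam i = Order.succ μ)
    (hlam : ∀ i, lam i < κ.ord) :
    CSHP ((Fin n → Iio κ.ord) × (∀ i : Fin j, Iio (lam i))) := by
  have : Nonempty (Iio κ.ord) := ⟨⟨0, hreg.ord_pos⟩⟩
  have : ∀ i, CompactSpace (Iio (lam i)) := fun i => by
    obtain ⟨μ, hμ⟩ := hsucc i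
    rw [hμ]
    exact Ordinal.compactSpace_Iio_succ μ
  -- All thresholds from the compact factors lie below `M`, so they are included in `S α` from the
  -- start.
  obtain ⟨M, hM⟩ := Finite.exists_le fun i : Fin j => (⟨lam i, hlam i⟩ : Iio κ.ord)
  let X := (Fin n → Iio κ.ord) × (∀ i : Fin j, Iio (lam i))
  let c : Fin n ⊕ Fin j → X → Ordinal.{u} := fun s x => s.elim (fun i => x.1 i) (fun i => x.2 i)
  have hc : ∀ s, Continuous (c s) := by
    rintro (i | i)
    · exact continuous_subtype_val.comp ((continuous_apply i).comp continuous_fst)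
    · exact continuous_subtype_val.comp ((continuous_apply i).comp continuous_snd)
  let K : Iio κ.ord → TopologicalSpace.Compacts X := fun α =>
    ⟨(univ.pi fun _ => Iic α) ×ˢ univ,
      (isCompact_univ_pi fun _ => Ordinal.isCompact_Iic_Iio α).prod isCompact_univ⟩
  have hmemK : ∀ α x, x ∈ K α ↔ ∀ i, x.1 i ≤ α := by
    intro α x
    change x ∈ (univ.pi fun _ => Iic α) ×ˢ univ ↔ _
    exact ⟨fun h i => h.1 i trivial, fun h => ⟨fun i _ => h i, trivial⟩⟩
  let φ : (Fin n ⊕ Fin j) × Ordinal.{u} → C(X, ℝ) := fun t =>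
    LocallyConstant.toContinuousMap
      (LocallyConstant.charFn ℝ ((Ordinal.isClopen_Iic t.2).preimage (hc t.1)))
  have hφ : ∀ t x, φ t x = indicator (c t.1 ⁻¹' Iic t.2) 1 x := fun t x => rfl
  have hφne : ∀ s x y, c s x < c s y → φ (s, c s x) x ≠ φ (s, c s x) y := by
    intro s x y hxy
    simp [hφ, hxy]
  refine CSHP.of_reflection K ?_ ?_ φ ?_ (fun α => univ ×ˢ Iic ((α ⊔ M : Iio κ.ord) : Ordinal))
    ?_ ?_ ?_
  · intro α β hαβ x hx
    exact (hmemK _ _).2 fun i => ((hmemK _ _).1 hx i).trans hαβ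
  · intro C hC
    have hb : ∀ i, ∃ b, ∀ x ∈ C, x.1 i ≤ b := by
      intro i
      obtain ⟨b, hb⟩ := (hC.image ((continuous_apply i).comp continuous_fst)).bddAbove
      exact ⟨b, fun x hx => hb ⟨x, hx, rfl⟩⟩
    choose b hb using hb
    obtain ⟨α, hα⟩ := Finite.exists_le b
    exact ⟨α, fun x hx => (hmemK _ _).2 fun i => (hb i x hx).trans (hα i)⟩
  · intro t x
    rw [hφ]
    by_cases h : x ∈ c t.1 ⁻¹' Iic t.2 <;> simp [h]
  · intro α β hαβ
    exact prod_mono_right (Iic_subset_Iic.2 (sup_le_sup_right hαβ M))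
  · intro α g
    refine Ordinal.bddAbove_range_Iio (Cardinal.lift_lt_cof_lift_ord hreg ?_) g
    rw [Cardinal.lift_id'.{u, u + 1}]
    have hκ' : Cardinal.aleph0 < Cardinal.lift.{u + 1} κ := by simpa using hκ
    -- There are fewer than `κ` thresholds up to `α ⊔ M`, hence fewer than `κ` tasks; regularity of
    -- `κ` bounds their supports.
    refine Cardinal.mk_finset_prod_nat_lt hκ' ?_
    rw [Cardinal.mk_congr (Equiv.Set.prod _ _), Cardinal.mk_prod]
    refine Cardinal.mul_lt_of_lt hκ'.le ?_ ?_
    · refine lt_trans ?_ hκ'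
      rw [Cardinal.lift_lt_aleph0]
      exact Cardinal.lt_aleph0_of_finite _
    · rw [Cardinal.lift_id'.{0, u + 1}, ← Order.Iio_succ, Cardinal.mk_Iio_ordinal, Cardinal.lift_lt,
        ← Cardinal.lt_ord]
      exact (Cardinal.isSuccLimit_ord hκ.le).succ_lt (α ⊔ M : Iio κ.ord).2
  · intro a ha
    obtain ⟨α, hα⟩ := Ordinal.exists_isLUB_Iio (g := a)
      (Ordinal.bddAbove_range_Iio (Cardinal.lift_lt_cof_lift_ord hreg (by simpa using hκ)) a)
    refine ⟨α, fun m => hα.1 ⟨m, rfl⟩, ?_⟩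
    have key : ∀ x ∈ K α, ∀ y ∈ K α, ∀ s, c s x < c s y → ∃ m,
        c s x ≤ ((a m ⊔ M : Iio κ.ord) : Ordinal) := by
      rintro x hx y hy (i | i) hxy
      · obtain ⟨_, ⟨m, rfl⟩, hm⟩ := (lt_isLUB_iff hα).1
          (show x.1 i < α from lt_of_lt_of_le hxy ((hmemK _ _).1 hy i))
        exact ⟨m, show x.1 i ≤ a m ⊔ M from hm.le.trans le_sup_left⟩
      · exact ⟨0, (x.2 i).2.le.trans ((hM i).trans le_sup_right)⟩
    intro x hx y hy hxy
    have hs : ∃ s, c s x ≠ c s y := by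
      by_contra! h
      exact hxy (Prod.ext (funext fun i => Subtype.ext (h (Sum.inl i)))
        (funext fun i => Subtype.ext (h (Sum.inr i))))
    obtain ⟨s, hs⟩ := hs
    rcases hs.lt_or_gt with h | h
    · obtain ⟨m, hm⟩ := key x hx y hy s h
      exact ⟨m, (s, c s x), ⟨mem_univ _, hm⟩, hφne s x y h⟩
    · obtain ⟨m, hm⟩ := key y hy x hx s h
      exact ⟨m, (s, c s y), ⟨mem_univ _, hm⟩, (hφne s y x h).symm⟩


/-! ### Linearly ordered spaces exhausted by `ω₁` many intervals -/

theorem compactIccSpace_of_exists_isLUB {X : Type*} [LinearOrder X] [TopologicalSpace X]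
    [OrderTopology X] (hLUB : ∀ s : Set X, s.Nonempty → BddAbove s → ∃ x, IsLUB s x)
    (hGLB : ∀ s : Set X, s.Nonempty → BddBelow s → ∃ x, IsGLB s x) : CompactIccSpace X := by
  classical
  refine ⟨fun {a b} => ?_⟩
  let inst : ConditionallyCompleteLinearOrder X :=
    { (inferInstance : LinearOrder X), (inferInstance : Lattice X) with
      -- The default `a` is also the value at `∅`, as the axioms for unbounded sets require.
      sSup := fun s => if h : s.Nonempty ∧ BddAbove s then (hLUB s h.1 h.2).choose else a
      sInf := fun s => if h : s.Nonempty ∧ BddBelow s then (hGLB s h.1 h.2).choose else a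
      isLUB_csSup := fun s h₁ h₂ => by
        rw [dif_pos ⟨h₁, h₂⟩]
        exact (hLUB s h₁ h₂).choose_spec
      isGLB_csInf := fun s h₁ h₂ => by
        rw [dif_pos ⟨h₁, h₂⟩]
        exact (hGLB s h₁ h₂).choose_spec
      csSup_of_not_bddAbove := fun s hs => by simp [hs]
      csInf_of_not_bddBelow := fun s hs => by simp [hs] }
  exact isCompact_Icc

/-- Countably many tasks per stage are bounded in `ω₁`. The strict `β < α` in `hsep` ensures that
the separating pair appears before the supremum. -/
theorem cshp_of_countable_separating {X : Type*} [LinearOrder X] [TopologicalSpace X]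
    [OrderTopology X] (lo hi : Iio (Ordinal.omega 1 : Ordinal.{0}) → X)
    (hlo : Antitone lo) (hhi : Monotone hi)
    (hcomp : ∀ α, IsCompact (Icc (lo α) (hi α)))
    (hcov : ∀ x, ∃ α, lo α ≤ x ∧ x ≤ hi α)
    (D : Iio (Ordinal.omega 1 : Ordinal.{0}) → Set X) (hD : Monotone D)
    (hcount : ∀ α, (D α).Countable)
    (hsep : ∀ α x y, lo α ≤ x → x < y → y ≤ hi α →
      ∃ β < α, ∃ d ∈ D β, ∃ d' ∈ D β, x ≤ d ∧ d < d' ∧ d' ≤ y) :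
    CSHP X := by
  have hX : Nonempty X := ⟨lo ⟨0, Ordinal.omega_pos 1⟩⟩
  have hex : ∀ t : X × X, ∃ φ : C(X, ℝ), (∀ x, φ x ∈ Icc (0 : ℝ) 1) ∧
      (t.1 < t.2 → EqOn φ 0 (Iic t.1) ∧ EqOn φ 1 (Ici t.2)) := by
    rintro ⟨d, d'⟩
    by_cases h : d < d'
    · obtain ⟨φ, h0, h1, hφ⟩ := exists_continuous_zero_one_of_isClosed (isClosed_Iic (a := d))
        (isClosed_Ici (a := d')) (Iic_disjoint_Ici.2 (not_le.2 h))
      exact ⟨φ, hφ, fun _ => ⟨h0, h1⟩⟩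
    · exact ⟨0, by simp, fun h' => absurd h' h⟩
  choose φ hφ hφ' using hex
  refine CSHP.of_reflection (fun α => ⟨Icc (lo α) (hi α), hcomp α⟩)
    (fun α β h => Icc_subset_Icc (hlo h) (hhi h)) ?_ φ hφ (fun α => D α ×ˢ D α)
    (fun α β h => prod_mono (hD h) (hD h)) ?_ ?_
  · intro C hC
    obtain ⟨b, hb⟩ := hC.bddAbove
    obtain ⟨c, hc⟩ := hC.bddBelow
    obtain ⟨β, -, hβ⟩ := hcov b
    obtain ⟨γ, hγ, -⟩ := hcov c
    exact ⟨β ⊔ γ, fun x hx => ⟨(hlo le_sup_right).trans (hγ.trans (hc hx)),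
      ((hb hx).trans hβ).trans (hhi le_sup_left)⟩⟩
  · intro α g
    have : Countable (D α ×ˢ D α : Set (X × X)) := ((hcount α).prod (hcount α)).to_subtype
    exact Ordinal.bddAbove_range_Iio (by simp) g
  · intro a ha
    obtain ⟨α, hα⟩ := Ordinal.exists_isLUB_Iio (g := a) (Ordinal.bddAbove_range_Iio (by simp) a)
    refine ⟨α, fun n => hα.1 ⟨n, rfl⟩, ?_⟩
    have key : ∀ x y, lo α ≤ x → x < y → y ≤ hi α →
        ∃ n, ∃ t ∈ D (a n) ×ˢ D (a n), φ t x ≠ φ t y := by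
      intro x y hx hxy hy
      obtain ⟨β, hβ, d, hd, d', hd', hxd, hdd, hdy⟩ := hsep α x y hx hxy hy
      obtain ⟨_, ⟨n, rfl⟩, hn⟩ := (lt_isLUB_iff hα).1 hβ
      refine ⟨n, (d, d'), ⟨hD hn.le hd, hD hn.le hd'⟩, ?_⟩
      rw [(hφ' (d, d') hdd).1 hxd, (hφ' (d, d') hdd).2 hdy]
      simp
    intro x hx y hy hxy
    rcases hxy.lt_or_gt with h | h
    · exact key x y hx.1 h hy.2
    · obtain ⟨n, t, ht, hne⟩ := key y x hy.1 h hx.2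
      exact ⟨n, t, ht, hne.symm⟩

/-! ### The closed long ray -/

namespace ClosedLongRay

/-- The point of the closed long ray with coordinates `a` and `t`. -/
def mk (a : Iio (Ordinal.omega 1 : Ordinal.{0})) (t : Ico (0 : ℝ) 1) : ClosedLongRay :=
  toLex (a, t)

theorem exists_eq_mk (x : ClosedLongRay) : ∃ a t, x = mk a t :=
  ⟨(ofLex x).1, (ofLex x).2, rfl⟩

theorem mk_lt_mk {a b : Iio (Ordinal.omega 1 : Ordinal.{0})} {s t : Ico (0 : ℝ) 1} :
    mk a s < mk b t ↔ a < b ∨ a = b ∧ s < t :=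
  Prod.Lex.toLex_lt_toLex

theorem mk_le_mk {a b : Iio (Ordinal.omega 1 : Ordinal.{0})} {s t : Ico (0 : ℝ) 1} :
    mk a s ≤ mk b t ↔ a < b ∨ a = b ∧ s ≤ t :=
  Prod.Lex.toLex_le_toLex

theorem origin_le (x : ClosedLongRay) : origin ≤ x := by
  obtain ⟨a, t, rfl⟩ := exists_eq_mk x
  change mk _ _ ≤ mk a t
  rw [mk_le_mk]
  rcases (zero_le (a := (a : Ordinal))).lt_or_eq with h | h
  · exact Or.inl h
  · exact Or.inr ⟨Subtype.ext h, t.2.1⟩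

/-- Take the least first coordinate occurring in `U`, then the infimum of the second coordinates in
that fibre; it stays below `1` because the fibre meets `U`. -/
theorem exists_isGLB {U : Set ClosedLongRay} (hU : U.Nonempty) : ∃ x, IsGLB U x := by
  obtain ⟨a, ⟨t₁, ht₁⟩, hmin⟩ := WellFounded.has_min
    (wellFounded_lt (α := Iio (Ordinal.omega 1 : Ordinal.{0}))) {a | ∃ t, mk a t ∈ U} (by
      obtain ⟨x, hx⟩ := hU
      obtain ⟨a, t, rfl⟩ := exists_eq_mk x
      exact ⟨a, t, hx⟩)
  let V : Set ℝ := {r | ∃ t : Ico (0 : ℝ) 1, mk a t ∈ U ∧ (t : ℝ) = r}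
  have hV : BddBelow V := ⟨0, by rintro _ ⟨t, -, rfl⟩; exact t.2.1⟩
  have hV' : V.Nonempty := ⟨t₁, t₁, ht₁, rfl⟩
  have h0 : 0 ≤ sInf V := le_csInf hV' (by rintro _ ⟨t, -, rfl⟩; exact t.2.1)
  have h1 : sInf V < 1 := (csInf_le hV ⟨t₁, ht₁, rfl⟩).trans_lt t₁.2.2
  refine ⟨mk a ⟨sInf V, h0, h1⟩, ?_, ?_⟩
  · intro x hx
    obtain ⟨b, t, rfl⟩ := exists_eq_mk x
    rw [mk_le_mk]
    rcases (not_lt.1 (hmin b ⟨t, hx⟩)).lt_or_eq with h | rfl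
    · exact Or.inl h
    · exact Or.inr ⟨rfl, csInf_le hV ⟨t, hx, rfl⟩⟩
  · intro x hx
    obtain ⟨b, s, rfl⟩ := exists_eq_mk x
    rw [mk_le_mk]
    rcases mk_le_mk.1 (hx ht₁) with h | ⟨rfl, h⟩
    · exact Or.inl h
    · refine Or.inr ⟨rfl, le_csInf hV' ?_⟩
      rintro _ ⟨t, ht, rfl⟩
      rcases mk_le_mk.1 (hx ht) with h | ⟨-, h⟩
      · exact absurd h (lt_irrefl _)
      · exact h

instance : CompactIccSpace ClosedLongRay :=
  compactIccSpace_of_exists_isLUB (fun _ _ hs => by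
    obtain ⟨x, hx⟩ := exists_isGLB hs
    exact ⟨x, isGLB_upperBounds.1 hx⟩) fun _ hs _ => exists_isGLB hs

/-- The point `(a, 0)` of the closed long ray. -/
def ofOrdinal (a : Iio (Ordinal.omega 1 : Ordinal.{0})) : ClosedLongRay :=
  mk a ⟨0, le_rfl, zero_lt_one⟩

theorem ofOrdinal_monotone : Monotone ofOrdinal := fun _ _ h =>
  mk_le_mk.2 (h.lt_or_eq.imp_right fun h => ⟨h, le_rfl⟩)

theorem exists_le_ofOrdinal (x : ClosedLongRay) : ∃ a, x ≤ ofOrdinal a := by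
  obtain ⟨a, t, rfl⟩ := exists_eq_mk x
  exact ⟨⟨Order.succ a, (Cardinal.isSuccLimit_omega 1).succ_lt a.2⟩,
    mk_le_mk.2 (Or.inl (Order.lt_succ (a : Ordinal)))⟩

/-- The points whose first coordinate is at most `a` and whose second coordinate is rational. -/
def rationalPoints (a : Iio (Ordinal.omega 1 : Ordinal.{0})) : Set ClosedLongRay :=
  {x | ∃ b ≤ a, ∃ (t : Ico (0 : ℝ) 1) (q : ℚ), (q : ℝ) = t ∧ x = mk b t}

theorem rationalPoints_monotone : Monotone rationalPoints := by
  rintro a a' h _ ⟨b, hb, t, q, hq, rfl⟩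
  exact ⟨b, hb.trans h, t, q, hq, rfl⟩

theorem countable_Iic (a : Iio (Ordinal.omega 1 : Ordinal.{0})) : (Iic a).Countable := by
  have h : (Iic (a : Ordinal.{0})).Countable := by
    rw [← Order.Iio_succ, ← Cardinal.le_aleph0_iff_set_countable, Cardinal.mk_Iio_ordinal,
      Cardinal.lift_le_aleph0, ← Cardinal.lt_aleph_one_iff, ← Cardinal.lt_ord, Cardinal.ord_aleph]
    exact (Cardinal.isSuccLimit_omega 1).succ_lt a.2
  exact (h.preimage Subtype.val_injective)

theorem countable_rationalPoints (a : Iio (Ordinal.omega 1 : Ordinal.{0})) :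
    (rationalPoints a).Countable := by
  have h : (range ((↑) : ℚ → ℝ)).Countable := countable_range _
  refine (((countable_Iic a).prod (h.preimage (f := ((↑) : Ico (0 : ℝ) 1 → ℝ))
    Subtype.val_injective)).image fun p => mk p.1 p.2).mono ?_
  rintro _ ⟨b, hb, t, q, hq, rfl⟩
  exact ⟨(b, t), ⟨hb, q, hq⟩, rfl⟩

theorem exists_rationalPoints_between {a : Iio (Ordinal.omega 1 : Ordinal.{0})}
    {x y : ClosedLongRay} (hxy : x < y) (hy : y ≤ ofOrdinal a) :
    ∃ b < a, ∃ d ∈ rationalPoints b, ∃ d' ∈ rationalPoints b, x ≤ d ∧ d < d' ∧ d' ≤ y := by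
  obtain ⟨b, s, rfl⟩ := exists_eq_mk x
  obtain ⟨c, t, rfl⟩ := exists_eq_mk y
  have hb : b < a := by
    rcases mk_lt_mk.1 (hxy.trans_le hy) with h | ⟨-, h⟩
    · exact h
    · exact absurd s.2.1 (not_le.2 h)
  -- `u` bounds the room above `x` in its own fibre: `1` if `y` lies in a later fibre, otherwise the
  -- second coordinate of `y`.
  obtain ⟨u, hsu, hu1, hu⟩ : ∃ u : ℝ, (s : ℝ) < u ∧ u ≤ 1 ∧
      ∀ r : Ico (0 : ℝ) 1, (r : ℝ) < u → mk b r ≤ mk c t := by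
    rcases mk_lt_mk.1 hxy with h | ⟨rfl, h⟩
    · exact ⟨1, s.2.2, le_rfl, fun r _ => mk_le_mk.2 (Or.inl h)⟩
    · exact ⟨t, h, t.2.2.le, fun r hr => mk_le_mk.2 (Or.inr ⟨rfl, hr.le⟩)⟩
  obtain ⟨q, hsq, hqu⟩ := exists_rat_btwn hsu
  obtain ⟨q', hqq', hqu'⟩ := exists_rat_btwn hqu
  refine ⟨b, hb, mk b ⟨q, s.2.1.trans hsq.le, hqu.trans_le hu1⟩, ⟨b, le_rfl, _, q, rfl, rfl⟩,
    mk b ⟨q', (s.2.1.trans hsq.le).trans hqq'.le, hqu'.trans_le hu1⟩,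
    ⟨b, le_rfl, _, q', rfl, rfl⟩, ?_, ?_, hu _ hqu'⟩
  · exact mk_le_mk.2 (Or.inr ⟨rfl, hsq.le⟩)
  · exact mk_lt_mk.2 (Or.inr ⟨rfl, hqq'⟩)

theorem cshp : CSHP ClosedLongRay :=
  cshp_of_countable_separating (fun _ => origin) ofOrdinal antitone_const ofOrdinal_monotone
    (fun _ => isCompact_Icc)
    (fun x => (exists_le_ofOrdinal x).imp fun _ h => ⟨origin_le x, h⟩)
    rationalPoints rationalPoints_monotone countable_rationalPoints
    fun _ _ _ _ hxy hy => exists_rationalPoints_between hxy hy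

end ClosedLongRay

/-! ### The long line -/

namespace LongLine

open ClosedLongRay

/-- The inclusion of the closed long ray as the nonnegative half of the long line. -/
noncomputable def pos (x : ClosedLongRay) : LongLine :=
  toLex (Sum.inr x)

/-- The point of the first copy of the closed long ray given by `x`. -/
noncomputable def ofIoi (x : Ioi origin) : LongLine :=
  toLex (Sum.inl (OrderDual.toDual x))

theorem ofIoi_lt_pos (x : Ioi origin) (y : ClosedLongRay) : ofIoi x < pos y :=
  Sum.Lex.inl_lt_inr _ _

open scoped Classical in
/-- The order-reversing inclusion of the closed long ray as the nonpositive half of the long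
line. -/
noncomputable def neg (x : ClosedLongRay) : LongLine :=
  if h : x ∈ Ioi origin then ofIoi ⟨x, h⟩ else pos origin

theorem neg_origin : neg origin = pos origin :=
  dif_neg self_notMem_Ioi

theorem neg_eq_ofIoi (x : Ioi origin) : neg x = ofIoi x :=
  dif_pos x.2

theorem pos_strictMono : StrictMono pos := fun _ _ h => Sum.Lex.inr_lt_inr_iff.2 h

theorem neg_le_pos (x y : ClosedLongRay) : neg x ≤ pos y := by
  rcases (origin_le x).lt_or_eq with h | rfl
  · rw [neg_eq_ofIoi ⟨x, h⟩]
    exact (ofIoi_lt_pos _ _).le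
  · rw [neg_origin]
    exact pos_strictMono.monotone (origin_le y)

theorem neg_strictAnti : StrictAnti neg := by
  intro x y h
  have hy : origin < y := (origin_le x).trans_lt h
  rw [neg_eq_ofIoi ⟨y, hy⟩]
  rcases (origin_le x).lt_or_eq with hx | rfl
  · rw [neg_eq_ofIoi ⟨x, hx⟩]
    exact Sum.Lex.inl_lt_inl_iff.2 h
  · rw [neg_origin]
    exact ofIoi_lt_pos _ _

theorem eq_pos_or_eq_neg (z : LongLine) : (∃ x, z = pos x) ∨ ∃ x, z = neg x := by
  rcases h : ofLex z with x | x
  · refine Or.inr ⟨(OrderDual.ofDual x).1, ?_⟩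
    rw [neg_eq_ofIoi (OrderDual.ofDual x)]
    exact h
  · exact Or.inl ⟨x, h⟩

theorem range_pos : range pos = Ici (pos origin) := by
  ext z
  constructor
  · rintro ⟨x, rfl⟩
    exact pos_strictMono.monotone (origin_le x)
  · intro hz
    rcases eq_pos_or_eq_neg z with ⟨x, rfl⟩ | ⟨x, rfl⟩
    · exact mem_range_self x
    · exact ⟨origin, le_antisymm hz (neg_le_pos _ _)⟩

theorem range_neg : range neg = Iic (pos origin) := by
  ext z
  constructor
  · rintro ⟨x, rfl⟩
    exact neg_le_pos _ _
  · intro hz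
    rcases eq_pos_or_eq_neg z with ⟨x, rfl⟩ | ⟨x, rfl⟩
    · exact ⟨origin, neg_origin.trans (le_antisymm (pos_strictMono.monotone (origin_le x)) hz)⟩
    · exact mem_range_self x

theorem continuous_pos : Continuous pos :=
  (pos_strictMono.isEmbedding_of_ordConnected (by rw [range_pos]; exact ordConnected_Ici)).continuous

theorem continuous_neg : Continuous neg := by
  have h : StrictMono (OrderDual.toDual ∘ neg) := fun _ _ h => neg_strictAnti h
  have hr : range (OrderDual.toDual ∘ neg) = Ici (OrderDual.toDual (pos origin)) :=
    Set.ext fun z => Set.ext_iff.1 range_neg (OrderDual.ofDual z)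
  exact continuous_ofDual.comp
    (h.isEmbedding_of_ordConnected (by rw [hr]; exact ordConnected_Ici)).continuous

theorem isCompact_Icc_neg_pos (x y : ClosedLongRay) : IsCompact (Icc (neg x) (pos y)) := by
  refine ((isCompact_Icc.image continuous_neg (s := Icc origin x)).union
    (isCompact_Icc.image continuous_pos (s := Icc origin y))).of_isClosed_subset isClosed_Icc ?_
  rintro z ⟨hz, hz'⟩
  rcases eq_pos_or_eq_neg z with ⟨w, rfl⟩ | ⟨w, rfl⟩
  · exact Or.inr ⟨w, ⟨origin_le w, pos_strictMono.le_iff_le.1 hz'⟩, rfl⟩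
  · exact Or.inl ⟨w, ⟨origin_le w, neg_strictAnti.le_iff_ge.1 hz⟩, rfl⟩

theorem cshp : CSHP LongLine := by
  refine cshp_of_countable_separating (fun a => neg (ofOrdinal a)) (fun a => pos (ofOrdinal a))
    (fun _ _ h => neg_strictAnti.antitone (ofOrdinal_monotone h))
    (fun _ _ h => pos_strictMono.monotone (ofOrdinal_monotone h))
    (fun _ => isCompact_Icc_neg_pos _ _) ?_
    (fun a => neg '' rationalPoints a ∪ pos '' rationalPoints a)
    (fun _ _ h => union_subset_union (image_mono (rationalPoints_monotone h))
      (image_mono (rationalPoints_monotone h)))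
    (fun a => ((countable_rationalPoints a).image _).union ((countable_rationalPoints a).image _))
    ?_
  · intro z
    rcases eq_pos_or_eq_neg z with ⟨w, rfl⟩ | ⟨w, rfl⟩
    · exact (exists_le_ofOrdinal w).imp fun a h => ⟨neg_le_pos _ _, pos_strictMono.monotone h⟩
    · exact (exists_le_ofOrdinal w).imp fun a h => ⟨neg_strictAnti.antitone h, neg_le_pos _ _⟩
  · intro a z w hz hzw hw
    -- If `w` is positive, replacing `z` by `z ⊔ pos origin` moves the pair into the positive half.
    -- Otherwise both points lie in the negative half, where the reversed order swaps `d` and `d'`.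
    rcases lt_or_ge (pos origin) w with h | h
    · obtain ⟨y, rfl⟩ : w ∈ range pos := range_pos ▸ h.le
      obtain ⟨x, hx⟩ : z ⊔ pos origin ∈ range pos :=
        range_pos ▸ (le_sup_right : pos origin ≤ z ⊔ pos origin)
      have hxy : x < y := pos_strictMono.lt_iff_lt.1 (hx ▸ sup_lt_iff.2 ⟨hzw, h⟩)
      obtain ⟨b, hb, d, hd, d', hd', h1, h2, h3⟩ :=
        exists_rationalPoints_between hxy (pos_strictMono.le_iff_le.1 hw)
      exact ⟨b, hb, pos d, Or.inr ⟨d, hd, rfl⟩, pos d', Or.inr ⟨d', hd', rfl⟩,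
        (hx ▸ le_sup_left : z ≤ pos x).trans (pos_strictMono.monotone h1), pos_strictMono h2,
        pos_strictMono.monotone h3⟩
    · obtain ⟨y, rfl⟩ : w ∈ range neg := range_neg ▸ h
      obtain ⟨x, rfl⟩ : z ∈ range neg := range_neg ▸ hzw.le.trans h
      obtain ⟨b, hb, d, hd, d', hd', h1, h2, h3⟩ :=
        exists_rationalPoints_between (neg_strictAnti.lt_iff_gt.1 hzw)
          (neg_strictAnti.le_iff_ge.1 hz)
      exact ⟨b, hb, neg d', Or.inl ⟨d', hd', rfl⟩, neg d, Or.inl ⟨d, hd, rfl⟩,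
        neg_strictAnti.antitone h3, neg_strictAnti h2, neg_strictAnti.antitone h1⟩

end LongLine

theorem theoremD :
    CSHP ClosedLongRay ∧
    CSHP LongLine ∧
    ∀ (κ : Cardinal.{u}), Cardinal.aleph0 < κ → κ.IsRegular →
      ∀ (n j : ℕ) (lam : Fin j → Ordinal.{u}),
        (∀ i, ∃ μ : Ordinal.{u}, lam i = Order.succ μ) → (∀ i, lam i < κ.ord) →
          CSHP ((Fin n → Set.Iio κ.ord) × (∀ i : Fin j, Set.Iio (lam i))) :=
  ⟨ClosedLongRay.cshp, LongLine.cshp, fun _ hκ hreg n j lam hsucc hlam =>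
    cshp_pi_ordinal_prod hκ hreg n j lam hsucc hlam⟩
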